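/- Let $k\ge 1$, $N\ge k$, and let $M_1,\dots,M_N\in\mathbb R^k$ be points with unit masses and centroid $C$. The hyperplanar moment of a hyperplane $\pi$ is $J_\pi=\sum_i \mathrm{dist}(M_i,\pi)^2$; a hyperplane of the best fit (among all hyperplanes, or among those containing a given point) is one that minimizes $J_\pi$. For a point $O$ let $J_O=\sum_i (M_i-O)(M_i-O)^T$. Let $J_1\le\dots\le J_k$ be the eigenvalues of $J_C$, and use Cartesian coordinates $x_1,\dots,x_k$ with origin $C$ along corresponding orthonormal eigenvectors. The associated confocal pencil of quadrics is $$\sum_{i=1}^k\frac{x_i^2}{\alpha_i-\lambda}=1,\qquad \alpha_i=\frac{J_1}{N}-\frac{J_i-J_1}{N}.$$ The Jacobi coordinates $\lambda_{1_P}\le\dots\le\lambda_{k_P}$ of a point $P=(x_1,\dots,x_k)$ are the roots in $\lambda$, with multiplicity, of this equation after clearing denominators, that is, of $\prod_i(\alpha_i-\lambda)-\sum_i x_i^2\prod_{j\ne i}(\alpha_j-\lambda)$; these are $k$ real numbers. Then for every point $P\in\mathbb R^k$: (a) A hyperplane of the best fit exists, and its hyperplanar moment is $J_1=N\lambda_{k_C}$.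 (b) A hyperplane of the best fit among the hyperplanes that contain $P$ exists, and its hyperplanar moment is $N(2\lambda_{k_C}-\lambda_{k_P})$. (c) Consider testing whether the hyperplane of the best fit contains $P$, for data $M_i$ with known positive definite error covariance matrix $G$. Let the test statistic be $\frac{N}{N-k+1}\,r$, where $r$ is the smallest root of $\det\left(\frac1N J_P-rG\right)=0$. Then, for every matrix $W$ with $WGW^T=I$ (for example $W=G^{-1/2}$), $$\frac{N}{N-k+1}\,r=\frac{N}{N-k+1}\,(2\lambda_{k_C}-\lambda_{k_P}),$$ where the Jacobi coordinates on the right are those of the system $WM_1,\dots,WM_N$, taken at its centroid and at the point $WP$. Its null distribution is approximated, for small errors, by Snedecor's F distribution with $(N-k+1)$ and $\infty$ degrees of freedom, that is, by the law of $\chi^2_{N-k+1}/(N-k+1)$, in the following sense. Let $N$, the point $P$ and the points $z_1,\dots,z_N$ be fixed, where $z_1,\dots,z_N$ and $P$ together affinely span a hyperplane. Let $S$ be a positive definite matrix, and let $M_i$ be independent with $M_i\sim\mathcal N(z_i,T^{-1}S)$, so that $G=T^{-1}S$. Then the test statistic converges in distribution to this F distribution as $T\to\infty$. -/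

import Mathlib

open MeasureTheory ProbabilityTheory Filter Topology
open scoped Matrix

noncomputable section

namespace RestrictedFit

/-- Euclidean space `ℝ^k`. -/
abbrev E (k : ℕ) : Type := EuclideanSpace ℝ (Fin k)

/-! ### Hyperplanes, hyperplanar moments and best fit (unit masses) -/

/-- An affine hyperplane of `ℝ^k`: a nonempty affine subspace of dimension `k - 1`. -/
def IsHyperplane {k : ℕ} (p : AffineSubspace ℝ (E k)) : Prop :=
  (p : Set (E k)).Nonempty ∧ Module.finrank ℝ p.direction + 1 = k

/-- The hyperplanar moment `∑ dᵢ²` of the unit masses `M i`, where `dᵢ` is the distance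
from `M i` to `p`. -/
def hyperplanarMoment {k N : ℕ} (M : Fin N → E k) (p : AffineSubspace ℝ (E k)) : ℝ :=
  ∑ i, Metric.infDist (M i) (p : Set (E k)) ^ 2

/-- `p` is a hyperplane of the best fit: it minimizes the hyperplanar moment. -/
def IsBestFit {k N : ℕ} (M : Fin N → E k) (p : AffineSubspace ℝ (E k)) : Prop :=
  IsHyperplane p ∧ ∀ q, IsHyperplane q → hyperplanarMoment M p ≤ hyperplanarMoment M q

/-- `p` is a hyperplane of the best fit among the hyperplanes that contain `P`. -/
def IsBestFitThrough {k N : ℕ} (M : Fin N → E k) (P : E k)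
    (p : AffineSubspace ℝ (E k)) : Prop :=
  IsHyperplane p ∧ P ∈ p ∧
    ∀ q, IsHyperplane q → P ∈ q → hyperplanarMoment M p ≤ hyperplanarMoment M q

/-! ### The hyperplanar inertia operator and its principal frame at the centroid -/

/-- The centroid of the unit masses `M i`. -/
def centroid {k N : ℕ} (M : Fin N → E k) : E k := (N : ℝ)⁻¹ • ∑ i, M i

/-- Matrix of the hyperplanar inertia operator at `O`: `∑ rⱼ rⱼᵀ` with `rⱼ = M j - O`. -/
def inertiaMatrix {k N : ℕ} (M : Fin N → E k) (O : E k) : Matrix (Fin k) (Fin k) ℝ :=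
  Matrix.of fun a b => ∑ j, (M j a - O a) * (M j b - O b)

theorem inertiaMatrix_isHermitian {k N : ℕ} (M : Fin N → E k) (O : E k) :
    (inertiaMatrix M O).IsHermitian := by
  ext a b
  simp [inertiaMatrix, mul_comm]

/-- The hyperplanar inertia operator at `O`. -/
def inertiaOperator {k N : ℕ} (M : Fin N → E k) (O : E k) : E k →ₗ[ℝ] E k :=
  Matrix.toEuclideanLin (inertiaMatrix M O)

theorem inertiaOperator_isSymmetric {k N : ℕ} (M : Fin N → E k) (O : E k) :
    (inertiaOperator M O).IsSymmetric :=
  Matrix.isSymmetric_toEuclideanLin_iff.mpr (inertiaMatrix_isHermitian M O)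

/-- The principal hyperplanar moments of inertia `J₁ ≤ ⋯ ≤ J_k`: the eigenvalues, in increasing
order and with multiplicity, of the inertia operator at the centroid. The index `0 : Fin k`
stands for `J₁`. (Mathlib lists the eigenvalues of a symmetric operator in decreasing order.) -/
def principalMoment {k N : ℕ} (M : Fin N → E k) (i : Fin k) : ℝ :=
  (inertiaOperator_isSymmetric M (centroid M)).eigenvalues finrank_euclideanSpace_fin i.rev

/-- Orthonormal principal axes: the `i`-th vector is an eigenvector for `principalMoment M i`. -/
def principalAxes {k N : ℕ} (M : Fin N → E k) : OrthonormalBasis (Fin k) ℝ (E k) :=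
  ((inertiaOperator_isSymmetric M (centroid M)).eigenvectorBasis
    finrank_euclideanSpace_fin).reindex Fin.revPerm

/-- Coordinates of `x` in the principal frame with origin at the centroid. -/
def principalCoord {k N : ℕ} (M : Fin N → E k) (x : E k) (i : Fin k) : ℝ :=
  (principalAxes M).repr (x - centroid M) i

/-! ### Confocal quadrics and Jacobi coordinates -/

/-- Clearing denominators in `∑ xᵢ² / (αᵢ - λ) = 1`: the polynomial
`∏ (αᵢ - λ) - ∑ xᵢ² ∏_{j ≠ i} (αⱼ - λ)` in `λ`. -/
def jacobiPoly {k : ℕ} (α x : Fin k → ℝ) : Polynomial ℝ :=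
  ∏ i, (Polynomial.C (α i) - Polynomial.X) -
    ∑ i, Polynomial.C (x i ^ 2) *
      ∏ j ∈ Finset.univ.erase i, (Polynomial.C (α j) - Polynomial.X)

/-- For `t` different from all `αᵢ`, `t` is a root of `jacobiPoly α x` exactly when `x` lies on the
quadric with parameter `t` of the confocal pencil. -/
theorem isRoot_jacobiPoly_iff {k : ℕ} (α x : Fin k → ℝ) (t : ℝ) (ht : ∀ i, α i ≠ t) :
    (jacobiPoly α x).IsRoot t ↔ ∑ i, x i ^ 2 / (α i - t) = 1 := by
  have h0 : ∀ i, α i - t ≠ 0 := fun i => sub_ne_zero.mpr (ht i)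
  have hp : ∏ i, (α i - t) ≠ 0 := Finset.prod_ne_zero_iff.mpr fun i _ => h0 i
  have key : ∑ i, x i ^ 2 * ∏ j ∈ Finset.univ.erase i, (α j - t) =
      (∑ i, x i ^ 2 / (α i - t)) * ∏ i, (α i - t) := by
    rw [Finset.sum_mul]
    refine Finset.sum_congr rfl fun i _ => ?_
    rw [← Finset.mul_prod_erase Finset.univ (fun i => α i - t) (Finset.mem_univ i)]
    field_simp [h0 i]
  have he : (jacobiPoly α x).eval t =
      ∏ i, (α i - t) - ∑ i, x i ^ 2 * ∏ j ∈ Finset.univ.erase i, (α j - t) := by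
    simp [jacobiPoly, Polynomial.eval_prod, Polynomial.eval_finsetSum]
  rw [Polynomial.IsRoot.def, he, key, sub_eq_zero, eq_comm, mul_eq_right₀ hp]

/-- For pairwise distinct `αᵢ`, the value `αᵢ` is a root of `jacobiPoly α x` exactly when `x` lies
on the coordinate hyperplane `xᵢ = 0`, the degenerate quadric with parameter `αᵢ`. -/
theorem isRoot_jacobiPoly_degenerate_iff {k : ℕ} (α x : Fin k → ℝ) (hα : Function.Injective α)
    (i : Fin k) : (jacobiPoly α x).IsRoot (α i) ↔ x i = 0 := by
  have he : (jacobiPoly α x).eval (α i) =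
      ∏ j, (α j - α i) - ∑ l, x l ^ 2 * ∏ j ∈ Finset.univ.erase l, (α j - α i) := by
    simp [jacobiPoly, Polynomial.eval_prod, Polynomial.eval_finsetSum]
  have h1 : ∏ j, (α j - α i) = 0 :=
    Finset.prod_eq_zero (Finset.mem_univ i) (sub_self _)
  have h2 : ∑ l, x l ^ 2 * ∏ j ∈ Finset.univ.erase l, (α j - α i) =
      x i ^ 2 * ∏ j ∈ Finset.univ.erase i, (α j - α i) := by
    refine Finset.sum_eq_single i (fun l _ hl => ?_) (by simp)
    rw [Finset.prod_eq_zero (i := i) (by simp [hl.symm]) (sub_self _), mul_zero]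
  have h3 : ∏ j ∈ Finset.univ.erase i, (α j - α i) ≠ 0 :=
    Finset.prod_ne_zero_iff.mpr fun j hj =>
      sub_ne_zero.mpr fun h => (Finset.ne_of_mem_erase hj) (hα h)
  rw [Polynomial.IsRoot.def, he, h1, h2]
  simp [h3]

/-- The parameters `αᵢ = J₁ / m - aᵢ²` of the confocal pencil associated with the system of points,
where `m = N` is the total mass and `J₁ + m aᵢ² = Jᵢ`. -/
def pencilParam {k N : ℕ} [NeZero k] (M : Fin N → E k) (i : Fin k) : ℝ :=
  principalMoment M 0 / N - (principalMoment M i - principalMoment M 0) / N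

/-- The Jacobi (elliptic) coordinates of `P` with respect to the confocal pencil
`∑ xᵢ² / (αᵢ - λ) = 1` associated with the system of points, with multiplicity. -/
def jacobiCoordinates {k N : ℕ} [NeZero k] (M : Fin N → E k) (P : E k) : Multiset ℝ :=
  (jacobiPoly (pencilParam M) (principalCoord M P)).roots

/-- The largest Jacobi coordinate `λ_{k_P}` of `P`. -/
def largestJacobi {k N : ℕ} [NeZero k] (M : Fin N → E k) (P : E k) : ℝ :=
  sSup {t | t ∈ jacobiCoordinates M P}

/-! ### The test statistic and the limiting F distribution -/

/-- `N / (N - k + 1) * (2 λ_{k_C} - λ_{k_P})`. -/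
def testStatistic {k N : ℕ} [NeZero k] (M : Fin N → E k) (P : E k) : ℝ :=
  (N : ℝ) / ((N : ℝ) - k + 1) * (2 * largestJacobi M (centroid M) - largestJacobi M P)

/-- The chi-squared distribution with `d` degrees of freedom: the law of the sum of the squares of
`d` independent standard normal variables. -/
def chiSquared (d : ℕ) : Measure ℝ :=
  (Measure.pi fun _ : Fin d => gaussianReal 0 1).map fun x => ∑ i, x i ^ 2

/-- Snedecor's F distribution with `d` and `∞` degrees of freedom: the law of `χ²_d / d`. -/
def snedecorFInf (d : ℕ) : Measure ℝ := (chiSquared d).map fun x => x / d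

instance (d : ℕ) : IsProbabilityMeasure (chiSquared d) :=
  Measure.isProbabilityMeasure_map (Measurable.aemeasurable (by fun_prop))

instance (d : ℕ) : IsProbabilityMeasure (snedecorFInf d) :=
  Measure.isProbabilityMeasure_map (Measurable.aemeasurable (by fun_prop))

end RestrictedFit

end

/-! A hyperplane through `q` with unit normal `n` has moment `∑ ⟪M i - q, n⟫²`. Fitting through `P`
is therefore the minimization of the quadratic form of `J_P` on the unit sphere, and the best moment
`minSq (M - P)` is the smallest eigenvalue of `J_P`.

The link to confocal quadrics is a matrix identity. In the principal frame the parallel axis theorem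
reads `J_P = diag(J_i) + N x xᵀ`, and `α_i = 2 J_1/N - J_i/N`, so `diag(α) - x xᵀ = 2 (J_1/N) I -
J_P/N`. By the matrix determinant lemma the Jacobi polynomial is, up to sign, the characteristic
polynomial of this symmetric matrix (`jacobiPoly_eq`). Its largest root is thus `2 J_1/N - minSq (M
- P)/N` (`isGreatest_jacobiCoordinates`), which equals `J_1/N` at the centroid. This gives (a) and
(b); congruence by `W` gives the formula in (c).

For the null distribution, whitening and an orthogonal change of coordinates turn the data, seen
from the transformed `P`, into `√T a_i + e_i` with `e_i` standard normal and the `a_i` spanning a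
space of dimension `k - 1`. Let `B u = (⟪a_i, u⟫)_i` and `F u = (⟪e_i, u⟫)_i`. Minimizing `‖√T B u +
F u‖²` for large `T` forces `u` towards the unit vector `±n` in `ker B`, and corrections of order
`1/√T` remove exactly the part of `F n` in `range B` (`tendsto_isLeast_norm_sq`). What remains is
the projection of a standard Gaussian vector of `ℝ^N` to a space of dimension `N - (k - 1)`, whose
squared norm is chi-squared. -/

noncomputable section
namespace RestrictedFit
open scoped RealInnerProductSpace

/-! ### Sums of squared linear forms and their minimum on the sphere -/

/-- The quadratic form `∑ ⟪X i, u⟫²` of a finite family of vectors. -/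
def sqForm {k N : ℕ} (X : Fin N → E k) (u : E k) : ℝ := ∑ i, ⟪X i, u⟫ ^ 2

/-- The minimum of `sqForm X` on the unit sphere. -/
def minSq {k N : ℕ} (X : Fin N → E k) : ℝ := sInf (sqForm X '' Metric.sphere 0 1)

variable {k N : ℕ}

theorem continuous_sqForm : Continuous fun p : (Fin N → E k) × E k => sqForm p.1 p.2 := by
  unfold sqForm
  fun_prop

theorem sqForm_smul (X : Fin N → E k) (c : ℝ) (u : E k) :
    sqForm X (c • u) = c ^ 2 * sqForm X u := by
  simp only [sqForm, inner_smul_right, mul_pow, Finset.mul_sum]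

theorem isLeast_minSq [NeZero k] (X : Fin N → E k) :
    IsLeast (sqForm X '' Metric.sphere 0 1) (minSq X) := by
  have hne : (Metric.sphere (0 : E k) 1).Nonempty := 
    ⟨EuclideanSpace.single 0 1, by simp⟩
  have hc : Continuous (sqForm X) := by
    unfold sqForm
    fun_prop
  have hK : IsCompact (sqForm X '' Metric.sphere 0 1) := (isCompact_sphere (0 : E k) 1).image hc
  exact hK.isLeast_sInf (hne.image _)

theorem minSq_le [NeZero k] (X : Fin N → E k) {u : E k} (hu : ‖u‖ = 1) :
    minSq X ≤ sqForm X u :=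
  (isLeast_minSq X).2 ⟨u, by simpa using hu, rfl⟩

theorem exists_sqForm_eq_minSq [NeZero k] (X : Fin N → E k) :
    ∃ u : E k, ‖u‖ = 1 ∧ sqForm X u = minSq X := by
  obtain ⟨u, hu, h⟩ := (isLeast_minSq X).1
  exact ⟨u, by simpa using hu, h⟩

/-- Continuity in the data makes the test statistic measurable. -/
theorem continuous_minSq : Continuous (minSq : (Fin N → E k) → ℝ) :=
  (isCompact_sphere (0 : E k) 1).continuous_sInf continuous_sqForm

/-- Applying a linear isometry to the family does not change the minimum. -/
theorem minSq_map_isometry (L : E k ≃ₗᵢ[ℝ] E k) (X : Fin N → E k) :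
    minSq (fun i => L (X i)) = minSq X := by
  have h : ∀ u, sqForm (fun i => L (X i)) (L u) = sqForm X u := fun u => by
    simp [sqForm, L.inner_map_map]
  unfold minSq
  congr 1
  ext t
  constructor
  · rintro ⟨u, hu, rfl⟩
    refine ⟨L.symm u, by simpa using hu, ?_⟩
    rw [← h, L.apply_symm_apply]
  · rintro ⟨u, hu, rfl⟩
    exact ⟨L u, by simpa using hu, h u⟩

/-! ### The inertia operator -/

theorem inner_inertiaOperator (M : Fin N → E k) (O u v : E k) :
    ⟪inertiaOperator M O u, v⟫ = ∑ j, ⟪M j - O, u⟫ * ⟪M j - O, v⟫ := by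
  simp only [inertiaOperator, inertiaMatrix, PiLp.inner_apply, Matrix.toLpLin_apply,
    Matrix.mulVec, dotProduct, Matrix.of_apply, RCLike.inner_apply, conj_trivial, PiLp.sub_apply]
  simp only [Finset.sum_mul, Finset.mul_sum]
  refine Eq.trans ?_ (Finset.sum_comm.trans (Finset.sum_congr rfl fun _ _ => Finset.sum_comm)).symm
  refine Finset.sum_congr rfl fun a _ => Finset.sum_congr rfl fun b _ =>
    Finset.sum_congr rfl fun j _ => ?_
  ring

theorem inner_inertiaOperator_self (M : Fin N → E k) (O u : E k) :
    ⟪inertiaOperator M O u, u⟫ = sqForm (fun i => M i - O) u := by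
  simp [inner_inertiaOperator, sqForm, sq]

theorem sum_sub_centroid (hN : N ≠ 0) (M : Fin N → E k) : ∑ i, (M i - centroid M) = 0 := by
  rw [Finset.sum_sub_distrib, Finset.sum_const, Finset.card_univ, Fintype.card_fin, centroid,
    ← Nat.cast_smul_eq_nsmul ℝ, smul_smul, mul_inv_cancel₀ (by exact_mod_cast hN), one_smul,
    sub_self]

/-- The parallel axis theorem. -/
theorem sqForm_sub (hN : N ≠ 0) (M : Fin N → E k) (P u : E k) :
    sqForm (fun i => M i - P) u =
      sqForm (fun i => M i - centroid M) u + N * ⟪P - centroid M, u⟫ ^ 2 := by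
  -- The cross term of the expanded square vanishes because deviations from the centroid sum to
  -- zero.
  have h : ∑ i, ⟪M i - centroid M, u⟫ = 0 := by
    rw [← sum_inner, sum_sub_centroid hN, inner_zero_left]
  have e : ∀ i, ⟪M i - P, u⟫ = ⟪M i - centroid M, u⟫ - ⟪P - centroid M, u⟫ := fun i => by
    rw [← inner_sub_left, sub_sub_sub_cancel_right]
  simp only [sqForm, e, sub_sq, Finset.sum_add_distrib, Finset.sum_sub_distrib,
    ← Finset.mul_sum, ← Finset.sum_mul, h]
  simp

theorem inertiaOperator_principalAxes (M : Fin N → E k) (i : Fin k) :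
    inertiaOperator M (centroid M) (principalAxes M i) =
      principalMoment M i • principalAxes M i := by
  simp only [principalAxes, OrthonormalBasis.reindex_apply, Fin.revPerm_symm, Fin.revPerm_apply,
    principalMoment, LinearMap.IsSymmetric.apply_eigenvectorBasis]
  rfl

theorem principalMoment_zero_le [NeZero k] (M : Fin N → E k) (i : Fin k) :
    principalMoment M 0 ≤ principalMoment M i := by
  unfold principalMoment
  apply LinearMap.IsSymmetric.eigenvalues_antitone
  exact Fin.rev_le_rev.2 (Fin.zero_le i)

theorem sqForm_sub_centroid (M : Fin N → E k) (u : E k) :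
    sqForm (fun i => M i - centroid M) u =
      ∑ i, principalMoment M i * (principalAxes M).repr u i ^ 2 := by
  rw [← inner_inertiaOperator_self, ← (principalAxes M).sum_inner_mul_inner]
  refine Finset.sum_congr rfl fun i _ => ?_
  rw [inertiaOperator_isSymmetric, inertiaOperator_principalAxes, inner_smul_right,
    (principalAxes M).repr_apply_apply, real_inner_comm]
  ring

theorem minSq_sub_centroid [NeZero k] (M : Fin N → E k) :
    minSq (fun i => M i - centroid M) = principalMoment M 0 := by
  refine (isLeast_minSq _).unique ⟨⟨principalAxes M 0, by simp, ?_⟩, ?_⟩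
  · rw [← inner_inertiaOperator_self, inertiaOperator_principalAxes, inner_smul_left]
    simp
  · rintro _ ⟨u, hu, rfl⟩
    have hu1 : ‖u‖ = 1 := by simpa using hu
    have h1 : ∑ i, (principalAxes M).repr u i ^ 2 = 1 := by
      rw [← EuclideanSpace.real_norm_sq_eq, LinearIsometryEquiv.norm_map, hu1, one_pow]
    rw [sqForm_sub_centroid, ← mul_one (principalMoment M 0), ← h1, Finset.mul_sum]
    gcongr with i
    exact principalMoment_zero_le M i

/-! ### Jacobi coordinates as eigenvalues -/

/-- The matrix determinant lemma for a rank-one perturbation of an invertible diagonal matrix.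
Invertibility is harmless here: the result is only needed at infinitely many values of a parameter.
-/
theorem det_diagonal_sub_vecMulVec {n : Type*} [Fintype n] [DecidableEq n] (d x : n → ℝ)
    (hd : ∀ i, d i ≠ 0) : (Matrix.diagonal d - Matrix.vecMulVec x x).det =
      ∏ i, d i - ∑ i, x i ^ 2 * ∏ j ∈ Finset.univ.erase i, d j := by
  have hu : IsUnit (Matrix.diagonal d).det := by
    rw [Matrix.det_diagonal]
    exact (Finset.prod_ne_zero_iff.2 fun i _ => hd i).isUnit
  have h : Matrix.diagonal d - Matrix.vecMulVec x x = Matrix.diagonal d +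
      Matrix.replicateCol Unit (-x) * Matrix.replicateRow Unit x := by
    ext i j
    simp [Matrix.vecMulVec_apply, Matrix.mul_apply, sub_eq_add_neg]
  rw [h, Matrix.det_add_replicateCol_mul_replicateRow hu, Matrix.det_diagonal]
  have hinv : (Matrix.diagonal d)⁻¹ = Matrix.diagonal fun i => (d i)⁻¹ := by
    refine Matrix.inv_eq_right_inv ?_
    simp [hd]
  have he : ∀ i, ∏ j ∈ Finset.univ.erase i, d j = (∏ j, d j) * (d i)⁻¹ := fun i => by
    rw [← Finset.mul_prod_erase _ _ (Finset.mem_univ i), mul_right_comm, mul_inv_cancel₀ (hd i),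
      one_mul]
  simp only [hinv, he, Matrix.det_unique, Matrix.add_apply, Matrix.one_apply_eq, mul_add, mul_one,
    sub_eq_add_neg, ← Finset.sum_neg_distrib]
  rw [Matrix.mul_apply]
  simp only [Matrix.mul_diagonal, Matrix.replicateRow_apply,
    Matrix.replicateCol_apply, Pi.neg_apply, Finset.mul_sum]
  congr 1
  refine Finset.sum_congr rfl fun i _ => ?_
  ring

/-- Both polynomials agree at every `t` outside the finite set of the `α i`, where the determinant
formula applies. The sign appears because `charpoly` is `det (t - A)` while clearing denominators
yields `det (A - t)`. -/
theorem jacobiPoly_eq (α x : Fin k → ℝ) :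
    jacobiPoly α x =
      Polynomial.C ((-1) ^ k) * (Matrix.diagonal α - Matrix.vecMulVec x x).charpoly := by
  have hfin : (Set.range α)ᶜ.Infinite := (Set.finite_range α).infinite_compl
  refine Polynomial.eq_of_infinite_eval_eq _ _ (hfin.mono fun t ht => ?_)
  have h := det_diagonal_sub_vecMulVec (fun i => α i - t) x
    fun i h => ht ⟨i, sub_eq_zero.1 h⟩
  have hm : Matrix.diagonal (fun i => α i - t) - Matrix.vecMulVec x x =
      -(Matrix.scalar (Fin k) t - (Matrix.diagonal α - Matrix.vecMulVec x x)) := by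
    ext i j
    by_cases hij : i = j
    · subst hij; simp; ring
    · simp [hij]
  rw [hm, Matrix.det_neg, Fintype.card_fin] at h
  simp [jacobiPoly, Polynomial.eval_prod, Polynomial.eval_finsetSum, Matrix.eval_charpoly, ← h]

theorem roots_jacobiPoly (α x : Fin k → ℝ) :
    (jacobiPoly α x).roots = (Matrix.diagonal α - Matrix.vecMulVec x x).charpoly.roots := by
  rw [jacobiPoly_eq, Polynomial.roots_C_mul _ (by positivity)]

theorem isHermitian_diagonal_sub_vecMulVec (α x : Fin k → ℝ) :
    (Matrix.diagonal α - Matrix.vecMulVec x x).IsHermitian := by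
  refine (Matrix.isHermitian_diagonal α).sub ?_
  ext i j
  simp [Matrix.vecMulVec_apply, mul_comm]

theorem mem_roots_charpoly_iff (A : Matrix (Fin k) (Fin k) ℝ) (t : ℝ) :
    t ∈ A.charpoly.roots ↔ (A - t • (1 : Matrix (Fin k) (Fin k) ℝ)).det = 0 := by
  rw [Polynomial.mem_roots A.charpoly_monic.ne_zero, Polynomial.IsRoot.def, Matrix.eval_charpoly,
    ← neg_sub, Matrix.det_neg, Matrix.smul_one_eq_diagonal]
  simp

theorem det_sub_smul_one_eq_zero_iff (A : Matrix (Fin k) (Fin k) ℝ) (t : ℝ) :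
    (A - t • (1 : Matrix (Fin k) (Fin k) ℝ)).det = 0 ↔
      ∃ u : E k, ‖u‖ = 1 ∧ Matrix.toEuclideanLin A u = t • u := by
  rw [← Matrix.exists_mulVec_eq_zero_iff]
  constructor
  · rintro ⟨v, hv, h⟩
    have hv' : WithLp.toLp 2 v ≠ (0 : E k) := by simpa using hv
    have hn := norm_ne_zero_iff.2 hv'
    refine ⟨‖WithLp.toLp 2 v‖⁻¹ • WithLp.toLp 2 v, by simp [norm_smul, hn], ?_⟩
    rw [map_smul, smul_comm t]
    congr 1
    rw [Matrix.sub_mulVec, Matrix.smul_mulVec, Matrix.one_mulVec, sub_eq_zero] at h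
    simp [Matrix.toLpLin_apply, h]
  · rintro ⟨u, hu, h⟩
    refine ⟨u.ofLp, fun h0 => ?_, ?_⟩
    · have : u = 0 := by ext i; simp [h0]
      simp [this] at hu
    · rw [Matrix.sub_mulVec, Matrix.smul_mulVec, Matrix.one_mulVec, sub_eq_zero]
      simpa [Matrix.toLpLin_apply] using congrArg WithLp.ofLp h

/-- An extremal point of the quadratic form of a symmetric matrix on the sphere is an
eigenvector. -/
theorem toEuclideanLin_eq_smul_of_isExtrOn {A : Matrix (Fin k) (Fin k) ℝ} (hA : A.IsHermitian)
    {u : E k} (hu : ‖u‖ = 1)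
    (h : IsExtrOn (fun v : E k => ⟪Matrix.toEuclideanLin A v, v⟫) (Metric.sphere 0 1) u) :
    Matrix.toEuclideanLin A u = ⟪Matrix.toEuclideanLin A u, u⟫ • u := by
  have hs : (Matrix.toEuclideanLin A).IsSymmetric := Matrix.isSymmetric_toEuclideanLin_iff.2 hA
  have hT : IsSelfAdjoint (Matrix.toEuclideanLin A).toContinuousLinearMap :=
    ContinuousLinearMap.isSelfAdjoint_iff_isSymmetric.2 hs
  have := hT.eq_smul_self_of_isLocalExtrOn_real (x₀ := u) (by rw [hu]; exact h.localize)
  simpa [ContinuousLinearMap.rayleighQuotient, ContinuousLinearMap.reApplyInnerSelf_apply, hu]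
    using this

/-- A maximizer of the quadratic form on the sphere is an eigenvector, so the maximum is a root;
conversely each root is the value of the form at a unit eigenvector. -/
theorem isGreatest_roots_charpoly {A : Matrix (Fin k) (Fin k) ℝ} (hA : A.IsHermitian) {m : ℝ}
    (hm : IsGreatest ((fun v : E k => ⟪Matrix.toEuclideanLin A v, v⟫) '' Metric.sphere 0 1) m) :
    IsGreatest {t | t ∈ A.charpoly.roots} m := by
  obtain ⟨⟨u, hu, rfl⟩, hmax⟩ := hm
  have hu1 : ‖u‖ = 1 := by simpa using hu
  refine ⟨(mem_roots_charpoly_iff A _).2 ((det_sub_smul_one_eq_zero_iff A _).2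
    ⟨u, hu1, toEuclideanLin_eq_smul_of_isExtrOn hA hu1
      (Or.inr fun v hv => hmax ⟨v, hv, rfl⟩)⟩), fun t ht => ?_⟩
  obtain ⟨v, hv, h⟩ := (det_sub_smul_one_eq_zero_iff A t).1 ((mem_roots_charpoly_iff A t).1 ht)
  refine hmax ⟨v, by simpa using hv, ?_⟩
  simp [h, inner_smul_left, hv]

theorem isLeast_det_inertiaMatrix_sub [NeZero k] (M : Fin N → E k) (O : E k) :
    IsLeast {s : ℝ | (inertiaMatrix M O - s • (1 : Matrix (Fin k) (Fin k) ℝ)).det = 0}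
      (minSq fun i => M i - O) := by
  obtain ⟨u, hu, h⟩ := exists_sqForm_eq_minSq fun i => M i - O
  have hA := inertiaMatrix_isHermitian M O
  refine ⟨(det_sub_smul_one_eq_zero_iff _ _).2 ⟨u, hu, ?_⟩, fun t ht => ?_⟩
  · rw [← h, ← inner_inertiaOperator_self]
    refine toEuclideanLin_eq_smul_of_isExtrOn hA hu (Or.inl fun v hv => ?_)
    change ⟪inertiaOperator M O u, u⟫ ≤ ⟪inertiaOperator M O v, v⟫
    rw [inner_inertiaOperator_self, inner_inertiaOperator_self, h]
    exact minSq_le _ (by simpa using hv)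
  · obtain ⟨v, hv, h⟩ := (det_sub_smul_one_eq_zero_iff _ t).1 ht
    have := minSq_le (fun i => M i - O) hv
    rw [← inner_inertiaOperator_self, inertiaOperator, h] at this
    simpa [inner_smul_left, hv] using this

theorem inner_toEuclideanLin_diagonal_sub_vecMulVec (α x : Fin k → ℝ) (c : E k) :
    ⟪Matrix.toEuclideanLin (Matrix.diagonal α - Matrix.vecMulVec x x) c, c⟫ =
      ∑ i, α i * c i ^ 2 - (∑ i, x i * c i) ^ 2 := by
  rw [map_sub, LinearMap.sub_apply, inner_sub_left]
  congr 1
  · simp only [PiLp.inner_apply, Matrix.toLpLin_apply, Matrix.mulVec_diagonal]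
    refine Finset.sum_congr rfl fun i _ => ?_
    simp
    ring
  · simp [PiLp.inner_apply, Matrix.toLpLin_apply, Matrix.mulVec, dotProduct, Matrix.vecMulVec_apply,
      sq, Finset.sum_mul, Finset.mul_sum]
    exact Finset.sum_congr rfl fun _ _ => Finset.sum_congr rfl fun _ _ => by ring

theorem isGreatest_jacobiCoordinates [NeZero k] (hN : N ≠ 0) (M : Fin N → E k) (P : E k) :
    IsGreatest {t | t ∈ jacobiCoordinates M P}
      (2 * (principalMoment M 0 / N) - minSq (fun i => M i - P) / N) := by
  have hN' : (N : ℝ) ≠ 0 := by exact_mod_cast hN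
  have hN0 : (0 : ℝ) < N := by positivity
  -- The identity `diag(α) - x xᵀ = 2 (J_1/N) I - J_P/N`, written for quadratic forms. The minus
  -- sign turns the minimum for `J_P` into the maximum for the Jacobi matrix.
  have key : ∀ u : E k, ‖u‖ = 1 → ⟪Matrix.toEuclideanLin (Matrix.diagonal (pencilParam M) -
      Matrix.vecMulVec (principalCoord M P) (principalCoord M P)) ((principalAxes M).repr u),
      (principalAxes M).repr u⟫ =
      2 * (principalMoment M 0 / N) - sqForm (fun i => M i - P) u / N := by
    intro u hu
    have h1 : ∑ i, (principalAxes M).repr u i ^ 2 = 1 := by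
      rw [← EuclideanSpace.real_norm_sq_eq, LinearIsometryEquiv.norm_map, hu, one_pow]
    have h2 : ∑ i, principalCoord M P i * (principalAxes M).repr u i = ⟪P - centroid M, u⟫ := by
      rw [← (principalAxes M).repr.inner_map_map]
      simp [PiLp.inner_apply, principalCoord, mul_comm]
    have h3 : ∑ i, pencilParam M i * (principalAxes M).repr u i ^ 2 =
        2 * (principalMoment M 0 / N) -
          (∑ i, principalMoment M i * (principalAxes M).repr u i ^ 2) / N := by
      rw [← mul_one (2 * _), ← h1, Finset.mul_sum, Finset.sum_div, ← Finset.sum_sub_distrib]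
      refine Finset.sum_congr rfl fun i _ => ?_
      unfold pencilParam
      ring
    rw [inner_toEuclideanLin_diagonal_sub_vecMulVec, h2, h3, sqForm_sub hN, sqForm_sub_centroid]
    field_simp
    ring
  unfold jacobiCoordinates
  rw [roots_jacobiPoly]
  refine isGreatest_roots_charpoly (isHermitian_diagonal_sub_vecMulVec _ _) ⟨?_, ?_⟩
  · obtain ⟨u, hu, h⟩ := exists_sqForm_eq_minSq fun i => M i - P
    exact ⟨(principalAxes M).repr u, by simpa using hu, by simpa only [h] using key u hu⟩
  · rintro _ ⟨c, hc, rfl⟩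
    have hu : ‖(principalAxes M).repr.symm c‖ = 1 := by simpa using hc
    have h := key _ hu
    rw [LinearIsometryEquiv.apply_symm_apply] at h
    simp only [h]
    gcongr
    exact minSq_le _ hu

theorem largestJacobi_eq [NeZero k] (hN : N ≠ 0) (M : Fin N → E k) (P : E k) :
    largestJacobi M P = 2 * (principalMoment M 0 / N) - minSq (fun i => M i - P) / N :=
  (isGreatest_jacobiCoordinates hN M P).csSup_eq

/-- A real symmetric matrix has all its eigenvalues in `ℝ`, so no root is lost. -/
theorem card_jacobiCoordinates [NeZero k] (M : Fin N → E k) (P : E k) :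
    Multiset.card (jacobiCoordinates M P) = k := by
  unfold jacobiCoordinates
  rw [roots_jacobiPoly,
    (isHermitian_diagonal_sub_vecMulVec (pencilParam M)
      (principalCoord M P)).roots_charpoly_eq_eigenvalues]
  simp

theorem principalMoment_zero_eq [NeZero k] (hN : N ≠ 0) (M : Fin N → E k) :
    principalMoment M 0 = N * largestJacobi M (centroid M) := by
  have hN' : (N : ℝ) ≠ 0 := by exact_mod_cast hN
  rw [largestJacobi_eq hN, minSq_sub_centroid]
  field_simp
  ring

theorem minSq_sub_eq [NeZero k] (hN : N ≠ 0) (M : Fin N → E k) (P : E k) :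
    minSq (fun i => M i - P) =
      N * (2 * largestJacobi M (centroid M) - largestJacobi M P) := by
  have hN' : (N : ℝ) ≠ 0 := by exact_mod_cast hN
  have h := principalMoment_zero_eq hN M
  rw [mul_sub, mul_left_comm, ← h, largestJacobi_eq hN M P]
  field_simp
  ring

theorem testStatistic_eq [NeZero k] (hN : N ≠ 0) (M : Fin N → E k) (P : E k) :
    testStatistic M P = minSq (fun i => M i - P) / ((N : ℝ) - k + 1) := by
  rw [testStatistic, minSq_sub_eq hN]
  ring

/-! ### Linear changes of coordinates and the pencil `J_P / N - s G` -/

theorem inertiaMatrix_map (W : Matrix (Fin k) (Fin k) ℝ) (M : Fin N → E k) (P : E k) :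
    inertiaMatrix (fun i => Matrix.toEuclideanLin W (M i)) (Matrix.toEuclideanLin W P) =
      W * inertiaMatrix M P * Wᵀ := by
  have h : ∀ (M : Fin N → E k) (P : E k), inertiaMatrix M P =
      ∑ j, Matrix.vecMulVec (M j - P).ofLp (M j - P).ofLp := fun M P => by
    ext a b
    simp [inertiaMatrix, Matrix.sum_apply, Matrix.vecMulVec_apply]
  rw [h, h, Finset.mul_sum, Finset.sum_mul]
  refine Finset.sum_congr rfl fun j _ => ?_
  rw [← map_sub, Matrix.mul_vecMulVec, Matrix.vecMulVec_mul, Matrix.vecMul_transpose,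
    Matrix.toLpLin_apply]

/-- Congruence by the invertible `W` sends `J_P` to the inertia matrix of the transformed points and
`G` to the identity, without changing when the determinant vanishes. The generalized eigenvalue
problem becomes an ordinary one with eigenvalue `N * s`. -/
theorem isLeast_det_inertiaMatrix_sub_smul [NeZero k] (hN : N ≠ 0) (M : Fin N → E k) (P : E k)
    {G W : Matrix (Fin k) (Fin k) ℝ} (hW : W * G * Wᵀ = 1) :
    IsLeast {s : ℝ | ((N : ℝ)⁻¹ • inertiaMatrix M P - s • G).det = 0}
      (minSq (fun i => Matrix.toEuclideanLin W (M i) - Matrix.toEuclideanLin W P) / N) := by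
  have hN' : (N : ℝ) ≠ 0 := by exact_mod_cast hN
  have hN0 : (0 : ℝ) < N := by positivity
  have hWdet : W.det ≠ 0 := fun h => by
    have := congrArg Matrix.det hW
    simp [Matrix.det_mul, h] at this
  have hset : ∀ s : ℝ, ((N : ℝ)⁻¹ • inertiaMatrix M P - s • G).det = 0 ↔
      (inertiaMatrix (fun i => Matrix.toEuclideanLin W (M i)) (Matrix.toEuclideanLin W P) -
        (N * s) • (1 : Matrix (Fin k) (Fin k) ℝ)).det = 0 := by
    intro s
    have : inertiaMatrix (fun i => Matrix.toEuclideanLin W (M i)) (Matrix.toEuclideanLin W P) -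
        (N * s) • (1 : Matrix (Fin k) (Fin k) ℝ) =
        (N : ℝ) • (W * ((N : ℝ)⁻¹ • inertiaMatrix M P - s • G) * Wᵀ) := by
      rw [inertiaMatrix_map, ← hW, mul_sub, sub_mul, smul_sub]
      simp [smul_smul, hN']
    rw [this, Matrix.det_smul, Matrix.det_mul, Matrix.det_mul, Matrix.det_transpose]
    simp [hWdet, hN']
  obtain ⟨h1, h2⟩ := isLeast_det_inertiaMatrix_sub
    (fun i => Matrix.toEuclideanLin W (M i)) (Matrix.toEuclideanLin W P)
  refine ⟨(hset _).2 ?_, fun s hs => ?_⟩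
  · rw [mul_div_cancel₀ _ hN']
    exact h1
  · rw [div_le_iff₀' hN0]
    exact h2 ((hset s).1 hs)

end RestrictedFit
end

noncomputable section
namespace RestrictedFit
open scoped RealInnerProductSpace
variable {k N : ℕ}

/-! ### Hyperplanes and best fit -/

/-- The foot of the perpendicular gives the upper bound, Cauchy–Schwarz against the unit normal the
lower one. -/
theorem infDist_eq_abs_inner {p : AffineSubspace ℝ (E k)} {n q : E k} (hn : ‖n‖ = 1)
    (hd : p.direction = (ℝ ∙ n)ᗮ) (hq : q ∈ p) (x : E k) :
    Metric.infDist x (p : Set (E k)) = |⟪x - q, n⟫| := by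
  have hmem : ∀ y, y ∈ p ↔ ⟪y - q, n⟫ = 0 := fun y => by
    rw [← AffineSubspace.vsub_right_mem_direction_iff_mem hq, hd, vsub_eq_sub,
      Submodule.mem_orthogonal_singleton_iff_inner_left]
  refine le_antisymm ?_ ((Metric.le_infDist ⟨q, hq⟩).2 fun y hy => ?_)
  · have hy : x - ⟪x - q, n⟫ • n ∈ p := by
      rw [hmem, sub_right_comm, inner_sub_left, inner_smul_left, real_inner_self_eq_norm_sq, hn]
      simp
    refine (Metric.infDist_le_dist_of_mem hy).trans_eq ?_
    rw [dist_eq_norm, sub_sub_cancel, norm_smul, hn, mul_one, Real.norm_eq_abs]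
  · have h : ⟪x - q, n⟫ = ⟪x - y, n⟫ := by
      rw [← sub_add_sub_cancel x y q, inner_add_left, (hmem y).1 hy, add_zero]
    rw [h, dist_eq_norm]
    simpa [hn] using abs_real_inner_le_norm (x - y) n

theorem exists_unit_span_singleton {V : Type*} [NormedAddCommGroup V] [InnerProductSpace ℝ V]
    {K : Submodule ℝ V} (h : Module.finrank ℝ K = 1) : ∃ n : V, ‖n‖ = 1 ∧ K = ℝ ∙ n := by
  obtain ⟨v, hv, hspan⟩ := finrank_eq_one_iff'.1 h
  have hv' : (v : V) ≠ 0 := by simpa using hv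
  have hn := norm_ne_zero_iff.2 hv'
  refine ⟨‖(v : V)‖⁻¹ • (v : V), by simp [norm_smul, hn], ?_⟩
  rw [Submodule.span_singleton_smul_eq (by simpa using hn)]
  refine le_antisymm (fun w hw => ?_) ((Submodule.span_singleton_le_iff_mem _ _).2 v.2)
  obtain ⟨c, hc⟩ := hspan ⟨w, hw⟩
  exact Submodule.mem_span_singleton.2 ⟨c, congrArg Subtype.val hc⟩

theorem IsHyperplane.exists_normal {p : AffineSubspace ℝ (E k)} (hp : IsHyperplane p) :
    ∃ n : E k, ‖n‖ = 1 ∧ p.direction = (ℝ ∙ n)ᗮ := by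
  have h1 : Module.finrank ℝ p.directionᗮ = 1 := by
    have h := p.direction.finrank_add_finrank_orthogonal
    rw [finrank_euclideanSpace_fin] at h
    have := hp.2
    omega
  obtain ⟨n, hn, h⟩ := exists_unit_span_singleton h1
  exact ⟨n, hn, by rw [← h, Submodule.orthogonal_orthogonal]⟩

theorem hyperplanarMoment_eq {p : AffineSubspace ℝ (E k)} {n q : E k} (hn : ‖n‖ = 1)
    (hd : p.direction = (ℝ ∙ n)ᗮ) (hq : q ∈ p) (M : Fin N → E k) :
    hyperplanarMoment M p = sqForm (fun i => M i - q) n := by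
  simp [hyperplanarMoment, sqForm, infDist_eq_abs_inner hn hd hq]

theorem isHyperplane_mk' {n : E k} (hn : ‖n‖ = 1) (q : E k) :
    IsHyperplane (AffineSubspace.mk' q (ℝ ∙ n)ᗮ) := by
  refine ⟨⟨q, AffineSubspace.self_mem_mk' _ _⟩, ?_⟩
  have hn0 : n ≠ 0 := fun h => by simp [h] at hn
  have h := (ℝ ∙ n).finrank_add_finrank_orthogonal
  rw [finrank_span_singleton hn0, finrank_euclideanSpace_fin] at h
  rw [AffineSubspace.direction_mk']
  omega

variable [NeZero k]

theorem minSq_le_hyperplanarMoment (M : Fin N → E k) {p : AffineSubspace ℝ (E k)} {q : E k}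
    (hp : IsHyperplane p) (hq : q ∈ p) :
    minSq (fun i => M i - q) ≤ hyperplanarMoment M p := by
  obtain ⟨n, hn, hd⟩ := hp.exists_normal
  rw [hyperplanarMoment_eq hn hd hq]
  exact minSq_le _ hn

theorem exists_hyperplanarMoment_eq_minSq (M : Fin N → E k) (P : E k) :
    ∃ p, IsHyperplane p ∧ P ∈ p ∧ hyperplanarMoment M p = minSq fun i => M i - P := by
  obtain ⟨n, hn, h⟩ := exists_sqForm_eq_minSq fun i => M i - P
  refine ⟨AffineSubspace.mk' P (ℝ ∙ n)ᗮ, isHyperplane_mk' hn P, AffineSubspace.self_mem_mk' _ _, ?_⟩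
  rw [← h, hyperplanarMoment_eq hn (AffineSubspace.direction_mk' _ _)
    (AffineSubspace.self_mem_mk' _ _)]

theorem exists_isBestFitThrough (M : Fin N → E k) (P : E k) : ∃ p, IsBestFitThrough M P p := by
  obtain ⟨p, hp, hP, h⟩ := exists_hyperplanarMoment_eq_minSq M P
  exact ⟨p, hp, hP, fun q hq hPq => h.trans_le (minSq_le_hyperplanarMoment M hq hPq)⟩

theorem IsBestFitThrough.hyperplanarMoment_eq {M : Fin N → E k} {P : E k}
    {p : AffineSubspace ℝ (E k)} (hp : IsBestFitThrough M P p) :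
    hyperplanarMoment M p = minSq fun i => M i - P := by
  obtain ⟨q, hq, hPq, h⟩ := exists_hyperplanarMoment_eq_minSq M P
  exact le_antisymm (h ▸ hp.2.2 q hq hPq) (minSq_le_hyperplanarMoment M hp.1 hp.2.1)

/-- The parallel axis term is nonnegative, so the unrestricted best fit is found among hyperplanes
through the centroid. -/
theorem minSq_sub_centroid_le (hN : N ≠ 0) (M : Fin N → E k) (P : E k) :
    minSq (fun i => M i - centroid M) ≤ minSq fun i => M i - P := by
  obtain ⟨u, hu, h⟩ := exists_sqForm_eq_minSq fun i => M i - P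
  rw [← h, sqForm_sub hN]
  exact (minSq_le _ hu).trans (le_add_of_nonneg_right (by positivity))

theorem minSq_sub_centroid_le_hyperplanarMoment (hN : N ≠ 0) (M : Fin N → E k)
    {p : AffineSubspace ℝ (E k)} (hp : IsHyperplane p) :
    minSq (fun i => M i - centroid M) ≤ hyperplanarMoment M p := by
  obtain ⟨q, hq⟩ := hp.1
  exact (minSq_sub_centroid_le hN M q).trans (minSq_le_hyperplanarMoment M hp hq)

theorem exists_isBestFit (hN : N ≠ 0) (M : Fin N → E k) : ∃ p, IsBestFit M p := by
  obtain ⟨p, hp, -, h⟩ := exists_hyperplanarMoment_eq_minSq M (centroid M)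
  exact ⟨p, hp, fun q hq => h.trans_le (minSq_sub_centroid_le_hyperplanarMoment hN M hq)⟩

theorem IsBestFit.hyperplanarMoment_eq (hN : N ≠ 0) {M : Fin N → E k}
    {p : AffineSubspace ℝ (E k)} (hp : IsBestFit M p) :
    hyperplanarMoment M p = principalMoment M 0 := by
  obtain ⟨q, hq, -, h⟩ := exists_hyperplanarMoment_eq_minSq M (centroid M)
  rw [← minSq_sub_centroid]
  exact le_antisymm (h ▸ hp.2 q hq) (minSq_sub_centroid_le_hyperplanarMoment hN M hp.1)

end RestrictedFit
end

noncomputable section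
namespace RestrictedFit
open scoped RealInnerProductSpace
variable {k N : ℕ}

/-! ### The smallest eigenvalue for small errors -/

/-- The linear map `u ↦ (⟪X i, u⟫)ᵢ`. -/
def pairing (X : Fin N → E k) : E k →ₗ[ℝ] E N where
  toFun u := WithLp.toLp 2 fun i => ⟪X i, u⟫
  map_add' u v := by ext i; simp [inner_add_right]
  map_smul' c u := by ext i; simp [inner_smul_right]

@[simp]
theorem pairing_apply (X : Fin N → E k) (u : E k) (i : Fin N) : pairing X u i = ⟪X i, u⟫ := rfl

theorem sqForm_eq_norm_sq (X : Fin N → E k) (u : E k) : sqForm X u = ‖pairing X u‖ ^ 2 := by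
  simp [EuclideanSpace.real_norm_sq_eq, sqForm]

theorem pairing_smul_add (a e : Fin N → E k) (t : ℝ) :
    pairing (fun i => t • a i + e i) = t • pairing a + pairing e := by
  ext u i
  simp [inner_add_left, inner_smul_left]

/-- Converts the dimension of the span of the true points into the dimension of the kernel, and so
into the rank that fixes the degrees of freedom. -/
theorem ker_pairing (X : Fin N → E k) :
    LinearMap.ker (pairing X) = (Submodule.span ℝ (Set.range X))ᗮ := by
  ext u
  rw [LinearMap.mem_ker, Submodule.mem_orthogonal]
  constructor
  · intro h v hv
    induction hv using Submodule.span_induction with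
    | mem x hx =>
      obtain ⟨i, rfl⟩ := hx
      simpa using congrArg (fun w : E N => w i) h
    | zero => simp
    | add x y _ _ hx hy => rw [inner_add_left, hx, hy, add_zero]
    | smul c x _ hx => rw [inner_smul_left, hx, mul_zero]
  · intro h
    ext i
    simpa using h (X i) (Submodule.subset_span ⟨i, rfl⟩)

section Limit

variable {V H : Type*} [NormedAddCommGroup V] [InnerProductSpace ℝ V] [FiniteDimensional ℝ V]
  [NormedAddCommGroup H] [InnerProductSpace ℝ H]

/-- A sequence of unit vectors on which `B` tends to zero approaches the kernel of `B`; when the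
kernel is spanned by one unit vector `n`, an even continuous function tends to its value at `n`. -/
theorem tendsto_of_tendsto_map_zero {B : V →ₗ[ℝ] H} {n : V}
    (hn : ‖n‖ = 1) (hB : LinearMap.ker B = ℝ ∙ n) {g : V → ℝ} (hg : Continuous g)
    (heven : ∀ v, g (-v) = g v) {u : ℕ → V} (hu : ∀ j, ‖u j‖ = 1)
    (hBu : Tendsto (fun j => B (u j)) atTop (𝓝 0)) :
    Tendsto (fun j => g (u j)) atTop (𝓝 (g n)) := by
  refine tendsto_of_subseq_tendsto fun ns hns => ?_
  obtain ⟨v, hv, φ, hφmono, hφ⟩ := (isCompact_sphere (0 : V) 1).tendsto_subseq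
    (x := fun j => u (ns j)) (fun j => by simpa using hu (ns j))
  have hφns : Tendsto (fun j => ns (φ j)) atTop atTop :=
    hns.comp hφmono.tendsto_atTop
  refine ⟨φ, ?_⟩
  have hBv : B v = 0 := by
    have hc : Continuous B := B.continuous_of_finiteDimensional
    exact tendsto_nhds_unique ((hc.tendsto v).comp hφ) (hBu.comp hφns)
  have hv1 : ‖v‖ = 1 := by simpa using hv
  have hvn : v ∈ ℝ ∙ n := hB ▸ LinearMap.mem_ker.2 hBv
  obtain ⟨c, rfl⟩ := Submodule.mem_span_singleton.1 hvn
  -- A unit vector on the line of `n` is `n` or `-n`; evenness of `g` removes the choice of sign.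
  have hgc : g (c • n) = g n := by
    rw [norm_smul, hn, mul_one, Real.norm_eq_abs] at hv1
    rcases eq_or_eq_neg_of_abs_eq hv1 with rfl | rfl
    · rw [one_smul]
    · rw [neg_one_smul, heven]
  rw [← hgc]
  exact (hg.tendsto _).comp hφ

/-- Near `n`, write `u = n - w/t`: then `t B u + F u` is `F n - B w` up to order `1/t`. Its norm is
least when `B w` is the projection of `F n` to `range B`, which leaves the component orthogonal to
that range. A squeeze makes this rigorous. -/
theorem tendsto_isLeast_norm_sq [FiniteDimensional ℝ H] {B F : V →ₗ[ℝ] H} {n : V} (hn : ‖n‖ = 1)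
    (hB : LinearMap.ker B = ℝ ∙ n) {t : ℕ → ℝ} (ht : Tendsto t atTop atTop) {m : ℕ → ℝ}
    (hm : ∀ j, IsLeast ((fun u => ‖t j • B u + F u‖ ^ 2) '' Metric.sphere 0 1) (m j)) :
    Tendsto m atTop (𝓝 (‖(LinearMap.range B)ᗮ.starProjection (F n)‖ ^ 2)) := by
  set Q := LinearMap.range B with hQ
  -- The optimal first-order correction: `B w` is the part of `F n` lying in `range B`.
  obtain ⟨w, hw⟩ : Q.starProjection (F n) ∈ Q := Submodule.starProjection_apply_mem _ _
  have hBn : B n = 0 := by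
    rw [← LinearMap.mem_ker, hB]
    exact Submodule.mem_span_singleton_self n
  have hdec : F n - B w = Qᗮ.starProjection (F n) := by
    rw [hw, Submodule.starProjection_orthogonal_val]
  have htinv : Tendsto (fun j => (t j)⁻¹) atTop (𝓝 0) := tendsto_inv_atTop_zero.comp ht
  -- Homogeneity extends minimality from the sphere to all vectors, so trial vectors need not be
  -- normalized.
  have hmle : ∀ j u, m j * ‖u‖ ^ 2 ≤ ‖t j • B u + F u‖ ^ 2 := by
    intro j u
    rcases eq_or_ne u 0 with rfl | hu
    · simp
    have hnu : ‖u‖ ≠ 0 := norm_ne_zero_iff.2 hu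
    have h := (hm j).2 ⟨‖u‖⁻¹ • u, by simp [norm_smul, hnu], rfl⟩
    simp only [map_smul] at h
    rw [smul_comm, ← smul_add, norm_smul, mul_pow, norm_inv, norm_norm] at h
    calc m j * ‖u‖ ^ 2 ≤ (‖u‖⁻¹ ^ 2 * ‖t j • B u + F u‖ ^ 2) * ‖u‖ ^ 2 := by gcongr
      _ = _ := by field_simp
  have hcB : Continuous B := B.continuous_of_finiteDimensional
  have hcF : Continuous F := F.continuous_of_finiteDimensional
  -- The trial vectors `n - t⁻¹ w` bound the minimum from above.
  have hupper : Tendsto (fun j => ‖F n - B w - (t j)⁻¹ • F w‖ ^ 2 / ‖n - (t j)⁻¹ • w‖ ^ 2) atTop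
      (𝓝 (‖Qᗮ.starProjection (F n)‖ ^ 2)) := by
    have h1 : Tendsto (fun j => ‖F n - B w - (t j)⁻¹ • F w‖ ^ 2) atTop
        (𝓝 (‖F n - B w - (0 : ℝ) • F w‖ ^ 2)) :=
      ((tendsto_const_nhds.sub (htinv.smul_const _)).norm).pow 2
    have h2 : Tendsto (fun j => ‖n - (t j)⁻¹ • w‖ ^ 2) atTop (𝓝 (‖n - (0 : ℝ) • w‖ ^ 2)) :=
      ((tendsto_const_nhds.sub (htinv.smul_const _)).norm).pow 2
    have h := h1.div h2 (by simp [hn])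
    simp only [zero_smul, sub_zero, hn, one_pow, div_one, hdec] at h ⊢
    exact h
  have hle : ∀ᶠ j in atTop,
      m j ≤ ‖F n - B w - (t j)⁻¹ • F w‖ ^ 2 / ‖n - (t j)⁻¹ • w‖ ^ 2 := by
    have h2 : Tendsto (fun j => ‖n - (t j)⁻¹ • w‖ ^ 2) atTop (𝓝 (‖n - (0 : ℝ) • w‖ ^ 2)) :=
      ((tendsto_const_nhds.sub (htinv.smul_const _)).norm).pow 2
    filter_upwards [ht.eventually_gt_atTop 0, h2.eventually_const_lt (u := 0) (by simp [hn])]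
      with j hj hpos
    rw [le_div_iff₀ hpos]
    refine (hmle j _).trans_eq ?_
    congr 2
    simp only [map_sub, map_smul, hBn, zero_sub, smul_neg, smul_smul, mul_inv_cancel₀ hj.ne',
      one_smul]
    abel
  -- The minimizers bound it from below, as `B` tends to zero along them.
  choose u hu hum using fun j => (hm j).1
  have hu1 : ∀ j, ‖u j‖ = 1 := fun j => by simpa using hu j
  have hBu : Tendsto (fun j => B (u j)) atTop (𝓝 0) := by
    obtain ⟨C, hC⟩ : ∃ C, ∀ v : V, ‖v‖ = 1 → ‖F v‖ ≤ C := by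
      obtain ⟨C, hC⟩ := ((isCompact_sphere (0 : V) 1).image hcF).isBounded.exists_norm_le
      exact ⟨C, fun v hv => hC _ ⟨v, by simpa using hv, rfl⟩⟩
    -- Testing with `n`, where `B` vanishes, bounds the minimum by `‖F n‖²` uniformly in `j`. Hence
    -- `t j • B (u j)` stays bounded and `B (u j)` tends to zero.
    have hmC : ∀ j, ‖t j • B (u j)‖ ≤ 2 * C := by
      intro j
      have h1 : m j ≤ ‖F n‖ ^ 2 := by
        have := hmle j n
        simpa [hn, hBn] using this
      have h2 : ‖t j • B (u j) + F (u j)‖ ≤ C := by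
        refine le_trans ?_ (hC n hn)
        exact (sq_le_sq₀ (norm_nonneg _) (norm_nonneg _)).1 ((hum j).trans_le h1)
      calc ‖t j • B (u j)‖ = ‖(t j • B (u j) + F (u j)) - F (u j)‖ := by rw [add_sub_cancel_right]
        _ ≤ C + C := (norm_sub_le _ _).trans (add_le_add h2 (hC _ (hu1 j)))
        _ = 2 * C := by ring
    have hlim : Tendsto (fun j => (t j)⁻¹ * (2 * C)) atTop (𝓝 0) := by
      simpa using htinv.mul_const (2 * C)
    refine squeeze_zero_norm' ?_ hlim
    filter_upwards [ht.eventually_gt_atTop 0] with j hj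
    have := hmC j
    rw [norm_smul, Real.norm_of_nonneg hj.le] at this
    rw [le_inv_mul_iff₀ hj]
    exact this
  have hlower := tendsto_of_tendsto_map_zero hn hB
    (g := fun v => ‖Qᗮ.starProjection (F v)‖ ^ 2) (by fun_prop)
    (fun v => by simp only [map_neg, norm_neg]) hu1 hBu
  refine tendsto_of_tendsto_of_tendsto_of_le_of_le' hlower hupper (Eventually.of_forall fun j => ?_)
    hle
  -- Projecting away from `range B` kills the diverging term and does not increase the norm, which
  -- yields the lower bound.
  have hproj : Qᗮ.starProjection (t j • B (u j) + F (u j)) = Qᗮ.starProjection (F (u j)) := by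
    have h0 : Qᗮ.starProjection (B (u j)) = 0 := by
      rw [Submodule.starProjection_apply_eq_zero_iff, Submodule.orthogonal_orthogonal]
      exact ⟨u j, rfl⟩
    rw [map_add, map_smul, h0, smul_zero, zero_add]
  rw [← hum j, ← hproj]
  refine pow_le_pow_left₀ (norm_nonneg _) ?_ 2
  exact Submodule.norm_starProjection_apply_le _ _

end Limit

theorem tendsto_minSq_smul_add [NeZero k] {a : Fin N → E k} {n : E k} (hn : ‖n‖ = 1)
    (ha : LinearMap.ker (pairing a) = ℝ ∙ n) (e : Fin N → E k) {t : ℕ → ℝ}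
    (ht : Tendsto t atTop atTop) :
    Tendsto (fun j => minSq fun i => t j • a i + e i) atTop
      (𝓝 (‖(LinearMap.range (pairing a))ᗮ.starProjection (pairing e n)‖ ^ 2)) := by
  refine tendsto_isLeast_norm_sq hn ha ht fun j => ?_
  have h := isLeast_minSq fun i => t j • a i + e i
  have he : sqForm (fun i => t j • a i + e i) =
      fun u => ‖t j • pairing a u + pairing e u‖ ^ 2 := by
    ext u
    rw [sqForm_eq_norm_sq, pairing_smul_add]
    rfl
  rwa [he] at h

end RestrictedFit
end

noncomputable section
namespace RestrictedFit
open scoped RealInnerProductSpace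
variable {k N : ℕ}

/-! ### Gaussian laws -/

theorem inner_toEuclideanLin_left (A : Matrix (Fin k) (Fin k) ℝ) (x y : E k) :
    ⟪Matrix.toEuclideanLin A x, y⟫ = ⟪x, Matrix.toEuclideanLin Aᵀ y⟫ := by
  have h := LinearMap.adjoint_inner_right (Matrix.toEuclideanLin A) x y
  rw [← Matrix.toEuclideanLin_conjTranspose_eq_adjoint, Matrix.conjTranspose_eq_transpose_of_trivial]
    at h
  exact h.symm

/-- The characteristic function sees `R` only through `‖Rᵀ t‖² = t ⬝ᵥ G *ᵥ t`. Any factor `R` of `G`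
is allowed, not just the symmetric square root; the factor used later is a multiple of `V⁻¹`. -/
theorem multivariateGaussian_eq_map (z : E k) {G R : Matrix (Fin k) (Fin k) ℝ}
    (hG : G.PosSemidef) (hR : R * Rᵀ = G) :
    multivariateGaussian z G =
      (stdGaussian (E k)).map fun x => z + Matrix.toEuclideanLin R x := by
  have hc : Continuous (Matrix.toEuclideanLin R) := LinearMap.continuous_of_finiteDimensional _
  have hmeas : Measurable fun x => z + Matrix.toEuclideanLin R x := by fun_prop
  have : IsProbabilityMeasure ((stdGaussian (E k)).map fun x => z + Matrix.toEuclideanLin R x) :=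
    Measure.isProbabilityMeasure_map hmeas.aemeasurable
  refine Measure.ext_of_charFun ?_
  ext t
  have h1 : ∀ x, Complex.exp (⟪z + Matrix.toEuclideanLin R x, t⟫ * Complex.I) =
      Complex.exp (⟪t, z⟫ * Complex.I) *
        Complex.exp (⟪x, Matrix.toEuclideanLin Rᵀ t⟫ * Complex.I) := by
    intro x
    rw [← Complex.exp_add, inner_add_left, inner_toEuclideanLin_left, real_inner_comm t z]
    push_cast
    ring_nf
  have h2 : ‖Matrix.toEuclideanLin Rᵀ t‖ ^ 2 = t ⬝ᵥ G *ᵥ t := by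
    rw [← real_inner_self_eq_norm_sq, inner_toEuclideanLin_left, Matrix.transpose_transpose, ← hR,
      ← Matrix.mulVec_mulVec, EuclideanSpace.inner_eq_star_dotProduct, dotProduct_comm]
    simp [Matrix.toLpLin_apply]
  rw [charFun_multivariateGaussian hG, charFun_apply,
    integral_map hmeas.aemeasurable (Measurable.aestronglyMeasurable (by fun_prop))]
  simp_rw [h1]
  rw [integral_const_mul, ← charFun_apply, charFun_stdGaussian, ← Complex.exp_add]
  congr 1
  rw [← h2]
  push_cast
  ring

theorem map_inner_stdGaussian {V : Type*} [NormedAddCommGroup V] [InnerProductSpace ℝ V]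
    [FiniteDimensional ℝ V] [MeasurableSpace V] [BorelSpace V] {n : V} (hn : ‖n‖ = 1) :
    (stdGaussian V).map (fun x => ⟪x, n⟫) = gaussianReal 0 1 := by
  have h : (fun x : V => ⟪x, n⟫) = innerSL ℝ n := by
    ext x
    simp [real_inner_comm]
  rw [h, IsGaussian.map_eq_gaussianReal, variance_dual_stdGaussian,
    integral_strongDual_stdGaussian, innerSL_apply_norm, hn]
  simp

/-- Pairing with a vector of `K` does not see the projection, so the characteristic functions
coincide. -/
theorem map_orthogonalProjection_stdGaussian {V : Type*} [NormedAddCommGroup V]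
    [InnerProductSpace ℝ V] [FiniteDimensional ℝ V] [MeasurableSpace V] [BorelSpace V]
    (K : Submodule ℝ V) : (stdGaussian V).map K.orthogonalProjectionOnto = stdGaussian K := by
  have hmeas : Measurable K.orthogonalProjectionOnto := by fun_prop
  have : IsProbabilityMeasure ((stdGaussian V).map K.orthogonalProjectionOnto) :=
    Measure.isProbabilityMeasure_map hmeas.aemeasurable
  refine Measure.ext_of_charFun ?_
  ext t
  rw [charFun_apply, integral_map hmeas.aemeasurable
    (Measurable.aestronglyMeasurable (by fun_prop)), charFun_stdGaussian]
  have h : ∀ x : V, ⟪K.orthogonalProjectionOnto x, t⟫ = ⟪x, (t : V)⟫ := fun x =>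
    Submodule.inner_orthogonalProjectionOnto_eq_of_mem_right t x
  simp_rw [h]
  rw [← charFun_apply, charFun_stdGaussian, Submodule.coe_norm]

theorem map_norm_sq_stdGaussian (V : Type*) [NormedAddCommGroup V] [InnerProductSpace ℝ V]
    [FiniteDimensional ℝ V] [MeasurableSpace V] [BorelSpace V] :
    (stdGaussian V).map (fun x => ‖x‖ ^ 2) = chiSquared (Module.finrank ℝ V) := by
  have h : ∀ x : Fin (Module.finrank ℝ V) → ℝ,
      ‖∑ i, x i • stdOrthonormalBasis ℝ V i‖ ^ 2 = ∑ i, x i ^ 2 := fun x => by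
    rw [← (stdOrthonormalBasis ℝ V).sum_sq_inner_right]
    refine Finset.sum_congr rfl fun i _ => ?_
    rw [(stdOrthonormalBasis ℝ V).orthonormal.inner_right_fintype]
  rw [stdGaussian, Measure.map_map (by fun_prop) (by fun_prop), chiSquared]
  congr 1
  ext x
  exact h x

theorem map_norm_sq_starProjection_stdGaussian {V : Type*} [NormedAddCommGroup V]
    [InnerProductSpace ℝ V] [FiniteDimensional ℝ V] [MeasurableSpace V] [BorelSpace V]
    (K : Submodule ℝ V) :
    (stdGaussian V).map (fun x => ‖K.starProjection x‖ ^ 2) = chiSquared (Module.finrank ℝ K) := by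
  rw [← map_norm_sq_stdGaussian K, ← map_orthogonalProjection_stdGaussian K,
    Measure.map_map (by fun_prop) (by fun_prop)]
  rfl

/-- The components `⟪e i, n⟫` are independent and standard normal because `n` has norm one. -/
theorem map_pairing_pi_stdGaussian {n : E k} (hn : ‖n‖ = 1) :
    (Measure.pi fun _ : Fin N => stdGaussian (E k)).map (fun e => pairing e n) =
      stdGaussian (E N) := by
  have h : (fun e : Fin N → E k => pairing e n) =
      WithLp.toLp 2 ∘ fun e i => (fun x : E k => ⟪x, n⟫) (e i) := rfl
  have : IsProbabilityMeasure ((stdGaussian (E k)).map fun x => ⟪x, n⟫) :=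
    Measure.isProbabilityMeasure_map (by fun_prop)
  have hpi := Measure.pi_map_pi (μ := fun _ : Fin N => stdGaussian (E k))
    (f := fun _ x => ⟪x, n⟫) fun _ => by fun_prop
  rw [h, ← Measure.map_map (by fun_prop) (by fun_prop), hpi, map_inner_stdGaussian hn]
  exact map_pi_eq_stdGaussian

theorem continuous_pairing_apply (n : E k) :
    Continuous fun e : Fin N → E k => pairing e n := by
  have h : (fun e : Fin N → E k => pairing e n) = fun e => WithLp.toLp 2 fun i => ⟪e i, n⟫ := rfl
  rw [h]
  fun_prop

theorem map_limit_pi_stdGaussian {n : E k} (hn : ‖n‖ = 1) (K : Submodule ℝ (E N)) :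
    (Measure.pi fun _ : Fin N => stdGaussian (E k)).map
      (fun e => ‖K.starProjection (pairing e n)‖ ^ 2 / Module.finrank ℝ K) =
      snedecorFInf (Module.finrank ℝ K) := by
  rw [snedecorFInf, ← map_norm_sq_starProjection_stdGaussian K, 
    ← map_pairing_pi_stdGaussian (N := N) (k := k) hn, Measure.map_map (by fun_prop) (continuous_pairing_apply n).measurable,
    Measure.map_map (by fun_prop) (Measurable.comp (by fun_prop)
      (continuous_pairing_apply n).measurable)]
  rfl

theorem minSq_map_orthogonal {O : Matrix (Fin k) (Fin k) ℝ} (hO : O * Oᵀ = 1)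
    (X : Fin N → E k) : minSq (fun i => Matrix.toEuclideanLin O (X i)) = minSq X := by
  have hO' : Oᵀ * O = 1 := mul_eq_one_comm.1 hO
  have h : ∀ x y : E k, ⟪Matrix.toEuclideanLin O x, Matrix.toEuclideanLin O y⟫ = ⟪x, y⟫ := by
    intro x y
    rw [inner_toEuclideanLin_left]
    congr 1
    simp [Matrix.toLpLin_apply, hO']
  exact minSq_map_isometry (((Matrix.toEuclideanLin O).isometryOfInner h).toLinearIsometryEquiv rfl) X

/-! ### The null distribution -/

theorem finrank_span_sub {z : Fin N → E k} {P : E k}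
    (h : IsHyperplane (affineSpan ℝ (insert P (Set.range z)))) :
    Module.finrank ℝ (Submodule.span ℝ (Set.range fun i => z i - P)) + 1 = k := by
  have hd : (affineSpan ℝ (insert P (Set.range z))).direction =
      Submodule.span ℝ (Set.range fun i => z i - P) := by
    rw [direction_affineSpan,
      vectorSpan_eq_span_vsub_set_right ℝ (Set.mem_insert P (Set.range z)), Set.image_insert_eq,
      ← Set.range_comp]
    simp only [vsub_eq_sub, sub_self, Submodule.span_insert_zero]
    rfl
  rw [← hd]
  exact h.2

theorem finrank_span_map {V : Matrix (Fin k) (Fin k) ℝ} (hV : IsUnit V.det) (x : Fin N → E k) :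
    Module.finrank ℝ (Submodule.span ℝ (Set.range fun i => Matrix.toEuclideanLin V (x i))) =
      Module.finrank ℝ (Submodule.span ℝ (Set.range x)) := by
  have hinj : Function.Injective (Matrix.toEuclideanLin V) := by
    intro u v huv
    have := congrArg (Matrix.toEuclideanLin V⁻¹) huv
    simpa [Matrix.toLpLin_apply, Matrix.nonsing_inv_mul V hV] using this
  have h : Set.range (fun i => Matrix.toEuclideanLin V (x i)) =
      Matrix.toEuclideanLin V '' Set.range x := Set.range_comp _ _
  rw [h, Submodule.span_image]
  exact (Submodule.equivMapOfInjective _ hinj _).finrank_eq.symm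

theorem finrank_ker_pairing {a : Fin N → E k}
    (h : Module.finrank ℝ (Submodule.span ℝ (Set.range a)) + 1 = k) :
    Module.finrank ℝ (LinearMap.ker (pairing a)) = 1 := by
  have h' := (Submodule.span ℝ (Set.range a)).finrank_add_finrank_orthogonal
  rw [← ker_pairing, finrank_euclideanSpace_fin] at h'
  omega

/-- Rank-nullity gives rank `k - 1`, hence the `N - k + 1` degrees of freedom. -/
theorem finrank_range_pairing_orthogonal {a : Fin N → E k}
    (h : Module.finrank ℝ (Submodule.span ℝ (Set.range a)) + 1 = k) :
    Module.finrank ℝ ↥(LinearMap.range (pairing a))ᗮ = N + 1 - k := by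
  have h1 := (pairing a).finrank_range_add_finrank_ker
  have h2 := (LinearMap.range (pairing a)).finrank_add_finrank_orthogonal
  rw [finrank_ker_pairing h, finrank_euclideanSpace_fin] at h1
  rw [finrank_euclideanSpace_fin] at h2
  omega

/-- The deterministic limit holds for every noise vector `e`, hence almost surely, hence in
distribution; it remains to identify the law of the limit. -/
theorem tendstoInDistribution_minSq [NeZero k] (hkN : k ≤ N) {a : Fin N → E k}
    (ha : Module.finrank ℝ (Submodule.span ℝ (Set.range a)) + 1 = k) {t : ℕ → ℝ}
    (ht : Tendsto t atTop atTop) :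
    TendstoInDistribution
      (fun j (e : Fin N → E k) => minSq (fun i => t j • a i + e i) / ((N : ℝ) - k + 1)) atTop
      (id : ℝ → ℝ) (fun _ => Measure.pi fun _ : Fin N => stdGaussian (E k))
      (snedecorFInf (N + 1 - k)) := by
  obtain ⟨n, hn, hker⟩ := exists_unit_span_singleton (finrank_ker_pairing ha)
  set K := (LinearMap.range (pairing a))ᗮ with hK
  have hKd : Module.finrank ℝ K = N + 1 - k := finrank_range_pairing_orthogonal ha
  have hKr : (Module.finrank ℝ K : ℝ) = (N : ℝ) - k + 1 := by
    rw [hKd, Nat.cast_sub (by omega)]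
    push_cast
    ring
  have hmeas : ∀ j, Measurable fun e : Fin N → E k =>
      minSq (fun i => t j • a i + e i) / ((N : ℝ) - k + 1) := fun j =>
    ((continuous_minSq.comp (g := minSq) (f := fun (e : Fin N → E k) i => t j • a i + e i)
      (by fun_prop)).div_const _).measurable
  have hlimm : Measurable fun e : Fin N → E k =>
      ‖K.starProjection (pairing e n)‖ ^ 2 / ((N : ℝ) - k + 1) := by
    have := continuous_pairing_apply (N := N) n
    exact Continuous.measurable (by fun_prop)
  have h := tendstoInDistribution_of_ae_tendsto (μ' := Measure.pi fun _ : Fin N => stdGaussian (E k))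
    (l := atTop) (fun j => (hmeas j).aemeasurable) hlimm.aemeasurable
    (ae_of_all _ fun e => (tendsto_minSq_smul_add hn hker e ht).div_const _)
  refine ⟨h.forall_aemeasurable, aemeasurable_id, ?_⟩
  -- Only the law of the limit matters, so the limit variable on the noise space may be replaced by
  -- `id` under the F law.
  convert h.tendsto using 2
  congr 1
  refine Subtype.ext ?_
  change Measure.map id _ = Measure.map _ _
  rw [Measure.map_id, ← hKr, map_limit_pi_stdGaussian hn, hKd]

/-- Scaling by `√T` absorbs the noise level: a whitening matrix of `S` itself can serve for all `T`
at once. -/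
theorem exists_decorrelation {S W : Matrix (Fin k) (Fin k) ℝ} {T : ℝ} (hT : 0 < T)
    (hW : W * (T⁻¹ • S) * Wᵀ = 1) : ∃ V : Matrix (Fin k) (Fin k) ℝ, V * S * Vᵀ = 1 := by
  refine ⟨(√T)⁻¹ • W, ?_⟩
  rw [← hW]
  simp only [Matrix.transpose_smul, Matrix.smul_mul, Matrix.mul_smul, smul_smul, ← mul_inv,
    Real.mul_self_sqrt hT.le]

theorem isUnit_det_of_mul_mul_transpose {V S : Matrix (Fin k) (Fin k) ℝ} (hV : V * S * Vᵀ = 1) :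
    IsUnit V.det := by
  rw [isUnit_iff_ne_zero]
  intro h
  have := congrArg Matrix.det hV
  simp [Matrix.det_mul, h] at this

/-- Data with independent Gaussian errors of covariance `G = R Rᵀ` have the law of `z + R e`, with
`e` standard normal. -/
theorem map_eq_map_pi_stdGaussian {Ω : Type*} [MeasurableSpace Ω] {μ : Measure Ω}
    [IsProbabilityMeasure μ] {z : Fin N → E k} {G R : Matrix (Fin k) (Fin k) ℝ}
    (hG : G.PosSemidef) (hR : R * Rᵀ = G) {M : Fin N → Ω → E k}
    (hM : ∀ i, HasLaw (M i) (multivariateGaussian (z i) G) μ) (hind : iIndepFun M μ) :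
    μ.map (fun ω i => M i ω) = (Measure.pi fun _ : Fin N => stdGaussian (E k)).map
      fun e i => z i + Matrix.toEuclideanLin R (e i) := by
  have hc : Continuous (Matrix.toEuclideanLin R) := LinearMap.continuous_of_finiteDimensional _
  have hmeas : ∀ i, Measurable fun x => z i + Matrix.toEuclideanLin R x := fun i => by fun_prop
  have hp : ∀ i, IsProbabilityMeasure ((stdGaussian (E k)).map
      fun x => z i + Matrix.toEuclideanLin R x) :=
    fun i => Measure.isProbabilityMeasure_map (hmeas i).aemeasurable
  have hpi := Measure.pi_map_pi (μ := fun _ : Fin N => stdGaussian (E k))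
    (f := fun i x => z i + Matrix.toEuclideanLin R x) fun i => (hmeas i).aemeasurable
  rw [(iIndepFun_iff_map_fun_eq_pi_map fun i => (hM i).aemeasurable).1 hind, hpi]
  congr 1
  ext1 i
  rw [(hM i).map_eq, multivariateGaussian_eq_map (z i) hG hR]

theorem mul_transpose_decorrelation {S V : Matrix (Fin k) (Fin k) ℝ} {T : ℝ} (hT : 0 < T)
    (hV : V * S * Vᵀ = 1) : ((√T)⁻¹ • V⁻¹) * ((√T)⁻¹ • V⁻¹)ᵀ = T⁻¹ • S := by
  have hu := isUnit_det_of_mul_mul_transpose hV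
  have hu' : IsUnit Vᵀ.det := by rwa [Matrix.det_transpose]
  have hS : V⁻¹ * (V⁻¹)ᵀ = S := by
    rw [Matrix.transpose_nonsing_inv]
    calc V⁻¹ * Vᵀ⁻¹ = V⁻¹ * (V * S * Vᵀ) * Vᵀ⁻¹ := by rw [hV, mul_one]
      _ = (V⁻¹ * V) * S * (Vᵀ * Vᵀ⁻¹) := by simp only [mul_assoc]
      _ = S := by rw [Matrix.nonsing_inv_mul V hu, Matrix.mul_nonsing_inv _ hu', one_mul, mul_one]
  simp only [Matrix.transpose_smul, Matrix.smul_mul, Matrix.mul_smul, smul_smul, ← mul_inv,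
    Real.mul_self_sqrt hT.le, hS]

/-- The decorrelated data have the same smallest moment as `√T a + e`. -/
theorem minSq_decorrelated {S V W : Matrix (Fin k) (Fin k) ℝ} {T : ℝ} (hT : 0 < T)
    (hV : V * S * Vᵀ = 1) (hW : W * (T⁻¹ • S) * Wᵀ = 1) (z e : Fin N → E k) (P : E k) :
    minSq (fun i => Matrix.toEuclideanLin W
        (z i + Matrix.toEuclideanLin ((√T)⁻¹ • V⁻¹) (e i)) - Matrix.toEuclideanLin W P) =
      minSq fun i => √T • Matrix.toEuclideanLin V (z i - P) + e i := by
  set R := (√T)⁻¹ • V⁻¹ with hR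
  have hu := isUnit_det_of_mul_mul_transpose hV
  -- `R` is a factor of the error covariance and `W` whitens that covariance, so `W * R` is
  -- orthogonal and leaves `minSq` unchanged.
  have hO : (W * R) * (W * R)ᵀ = 1 := by
    rw [Matrix.transpose_mul, ← hW, ← mul_transpose_decorrelation hT hV]
    simp only [mul_assoc, hR]
  have hRV : R * (√T • V) = 1 := by
    rw [hR, Matrix.smul_mul, Matrix.mul_smul, smul_smul, inv_mul_cancel₀ (Real.sqrt_pos.2 hT).ne',
      one_smul, Matrix.nonsing_inv_mul V hu]
  have hmul : ∀ (A B : Matrix (Fin k) (Fin k) ℝ) (x : E k),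
      Matrix.toEuclideanLin (A * B) x = Matrix.toEuclideanLin A (Matrix.toEuclideanLin B x) :=
    fun A B x => by simp [Matrix.toLpLin_apply]
  rw [← minSq_map_orthogonal hO fun i => √T • Matrix.toEuclideanLin V (z i - P) + e i]
  congr 1
  ext1 i
  have hcancel : ∀ x, Matrix.toEuclideanLin R (√T • Matrix.toEuclideanLin V x) = x := fun x => by
    rw [← LinearMap.smul_apply, ← map_smul, ← hmul, hRV]
    simp
  rw [hmul, map_add (Matrix.toEuclideanLin R), hcancel]
  simp only [map_add, map_sub]
  abel

/-- For each `n` the statistic has exactly the law of the model `√T a + e` on the fixed noise space: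
different whitening matrices differ by an orthogonal factor. The sample spaces and the `W n` may
therefore vary with `n`. -/
theorem tendstoInDistribution_testStatistic [NeZero k] (hkN : k ≤ N) {z : Fin N → E k} {P : E k}
    (hz : IsHyperplane (affineSpan ℝ (insert P (Set.range z))))
    {S : Matrix (Fin k) (Fin k) ℝ} (hS : S.PosDef) {T : ℕ → ℝ} (hT : ∀ n, 0 < T n)
    (hTlim : Tendsto T atTop atTop) {W : ℕ → Matrix (Fin k) (Fin k) ℝ}
    (hW : ∀ n, W n * ((T n)⁻¹ • S) * (W n)ᵀ = 1)
    {Ω : ℕ → Type*} [∀ n, MeasurableSpace (Ω n)] (μ : ∀ n, Measure (Ω n))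
    [∀ n, IsProbabilityMeasure (μ n)] {M : ∀ n, Fin N → Ω n → E k}
    (hM : ∀ n i, HasLaw (M n i) (multivariateGaussian (z i) ((T n)⁻¹ • S)) (μ n))
    (hind : ∀ n, iIndepFun (M n) (μ n)) :
    TendstoInDistribution
      (fun n ω => testStatistic (fun i => Matrix.toEuclideanLin (W n) (M n i ω))
        (Matrix.toEuclideanLin (W n) P))
      atTop (id : ℝ → ℝ) μ (snedecorFInf (N + 1 - k)) := by
  have hN : N ≠ 0 := by
    have := NeZero.ne k
    omega
  -- A single `V`, taken from `W 0`, keeps the vectors `a i = V (z i - P)` independent of `n`.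
  obtain ⟨V, hV⟩ := exists_decorrelation (hT 0) (hW 0)
  have h := tendstoInDistribution_minSq hkN (a := fun i => Matrix.toEuclideanLin V (z i - P))
    (by rw [finrank_span_map (isUnit_det_of_mul_mul_transpose hV)]; exact finrank_span_sub hz)
    (Real.tendsto_sqrt_atTop.comp hTlim)
  simp_rw [testStatistic_eq hN]
  have hcont : ∀ n, Continuous fun X : Fin N → E k => minSq (fun i =>
      Matrix.toEuclideanLin (W n) (X i) - Matrix.toEuclideanLin (W n) P) / ((N : ℝ) - k + 1) := by
    intro n
    have hc : Continuous (Matrix.toEuclideanLin (W n)) :=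
      LinearMap.continuous_of_finiteDimensional _
    exact (continuous_minSq.comp (g := minSq) (f := fun (X : Fin N → E k) i =>
      Matrix.toEuclideanLin (W n) (X i) - Matrix.toEuclideanLin (W n) P) (by fun_prop)).div_const _
  have hMm : ∀ n, AEMeasurable (fun ω i => M n i ω) (μ n) := fun n =>
    aemeasurable_pi_lambda _ fun i => (hM n i).aemeasurable
  refine ⟨fun n => (hcont n).measurable.comp_aemeasurable (hMm n), aemeasurable_id, ?_⟩
  refine h.tendsto.congr fun n => ?_
  refine Subtype.ext ?_
  change Measure.map _ _ = Measure.map _ _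
  have hc : Continuous (Matrix.toEuclideanLin ((√(T n))⁻¹ • V⁻¹)) :=
    LinearMap.continuous_of_finiteDimensional _
  have hcomp := AEMeasurable.map_map_of_aemeasurable (hcont n).aemeasurable (hMm n)
  refine Eq.symm (hcomp.symm.trans ?_)
  rw [map_eq_map_pi_stdGaussian (hS.posSemidef.smul (inv_nonneg.2 (hT n).le))
    (mul_transpose_decorrelation (hT n) hV) (hM n) (hind n),
    Measure.map_map (hcont n).measurable (by fun_prop)]
  congr 1
  ext e
  exact congrArg (· / ((N : ℝ) - k + 1)) (minSq_decorrelated (hT n) hV (hW n) z e P)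

end RestrictedFit
end

theorem theorem6p6 {k N : ℕ} [NeZero k] (hkN : k ≤ N) :
    -- the Jacobi coordinates are `k` real numbers, and `largestJacobi` is the largest of them
    (∀ (M : Fin N → RestrictedFit.E k) (P : RestrictedFit.E k),
      Multiset.card (RestrictedFit.jacobiCoordinates M P) = k ∧
      IsGreatest {t | t ∈ RestrictedFit.jacobiCoordinates M P}
        (RestrictedFit.largestJacobi M P)) ∧
    -- (a) the hyperplane of the best fit
    (∀ M : Fin N → RestrictedFit.E k,
      (∃ p, RestrictedFit.IsBestFit M p) ∧
      (∀ p, RestrictedFit.IsBestFit M p →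
        RestrictedFit.hyperplanarMoment M p = RestrictedFit.principalMoment M 0) ∧
      RestrictedFit.principalMoment M 0 =
        N * RestrictedFit.largestJacobi M (RestrictedFit.centroid M)) ∧
    -- (b) the hyperplane of the best fit that contains `P`
    (∀ (M : Fin N → RestrictedFit.E k) (P : RestrictedFit.E k),
      (∃ p, RestrictedFit.IsBestFitThrough M P p) ∧
      ∀ p, RestrictedFit.IsBestFitThrough M P p →
        RestrictedFit.hyperplanarMoment M p =
          N * (2 * RestrictedFit.largestJacobi M (RestrictedFit.centroid M) -
            RestrictedFit.largestJacobi M P)) ∧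
    -- (c), the formula: for data with error covariance `G`, the errors-in-variables statistic
    -- `N / (N - k + 1) * r`, with `r` the smallest root of `det (J_P / N - r G) = 0`, is given
    -- by the Jacobi coordinates in coordinates that are orthonormal for the error covariance
    (∀ (M : Fin N → RestrictedFit.E k) (P : RestrictedFit.E k)
      (G : Matrix (Fin k) (Fin k) ℝ), G.PosDef →
      ∀ W : Matrix (Fin k) (Fin k) ℝ, W * G * Wᵀ = 1 →
      ∃ r : ℝ,
        IsLeast {s : ℝ | ((N : ℝ)⁻¹ • RestrictedFit.inertiaMatrix M P - s • G).det = 0} r ∧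
        (N : ℝ) / ((N : ℝ) - k + 1) * r =
          RestrictedFit.testStatistic (fun i => Matrix.toEuclideanLin W (M i))
            (Matrix.toEuclideanLin W P)) ∧
    -- (c), the null distribution: the true points `z i` lie on a hyperplane through `P`, which
    -- they span together with `P`; the observed points have independent `N(0, S / T)` errors
    (∀ (z : Fin N → RestrictedFit.E k) (P : RestrictedFit.E k),
      RestrictedFit.IsHyperplane (affineSpan ℝ (insert P (Set.range z))) →
      ∀ S : Matrix (Fin k) (Fin k) ℝ, S.PosDef →
      ∀ T : ℕ → ℝ, (∀ n, 0 < T n) → Tendsto T atTop atTop →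
      ∀ W : ℕ → Matrix (Fin k) (Fin k) ℝ, (∀ n, W n * ((T n)⁻¹ • S) * (W n)ᵀ = 1) →
      ∀ (Ω : ℕ → Type*) [∀ n, MeasurableSpace (Ω n)] (μ : ∀ n, Measure (Ω n))
        [∀ n, IsProbabilityMeasure (μ n)] (M : ∀ n, Fin N → Ω n → RestrictedFit.E k),
      (∀ n i, HasLaw (M n i) (multivariateGaussian (z i) ((T n)⁻¹ • S)) (μ n)) →
      (∀ n, iIndepFun (M n) (μ n)) →
      TendstoInDistribution
        (fun n ω => RestrictedFit.testStatistic
          (fun i => Matrix.toEuclideanLin (W n) (M n i ω)) (Matrix.toEuclideanLin (W n) P))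
        atTop (id : ℝ → ℝ) μ (RestrictedFit.snedecorFInf (N + 1 - k))) := by
  have hN : N ≠ 0 := by
    have := NeZero.ne k
    omega
  refine ⟨fun M P => ⟨RestrictedFit.card_jacobiCoordinates M P, ?_⟩, fun M => ?_, fun M P => ?_,
    fun M P G _ W hW => ?_, ?_⟩
  · rw [RestrictedFit.largestJacobi_eq hN]
    exact RestrictedFit.isGreatest_jacobiCoordinates hN M P
  · exact ⟨RestrictedFit.exists_isBestFit hN M, fun p hp => hp.hyperplanarMoment_eq hN,
      RestrictedFit.principalMoment_zero_eq hN M⟩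
  · exact ⟨RestrictedFit.exists_isBestFitThrough M P, fun p hp => by
      rw [hp.hyperplanarMoment_eq, RestrictedFit.minSq_sub_eq hN]⟩
  · refine ⟨_, RestrictedFit.isLeast_det_inertiaMatrix_sub_smul hN M P hW, ?_⟩
    rw [RestrictedFit.testStatistic_eq hN]
    have hN' : (N : ℝ) ≠ 0 := by exact_mod_cast hN
    field_simp
  · intro z P hz S hS T hT hTlim W hW Ω _ μ _ M hM hind
    exact RestrictedFit.tendstoInDistribution_testStatistic hkN hz hS hT hTlim hW μ hM hind
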